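/- Let $\Sigma$ be a finite alphabet, $\Sigma_\$=\Sigma\cup\{\$\}$ with a termination symbol $\$\notin\Sigma$, and $\Delta(\Sigma_\$)$ the set of probability distributions on $\Sigma_\$$; put $\mathsf{supp}(\rho)=\{\sigma\in\Sigma:\rho(\sigma)>0\}$. A PDFA $\mathcal A=(Q,q_{in},\pi,\tau)$ has a finite state set $Q$, $q_{in}\in Q$, and total maps $\pi:Q\to\Delta(\Sigma_\$)$, $\tau:Q\times\Sigma\to Q$; it defines the language model $\mathcal L(u)=\pi(\tau^*(u))$, $u\in\Sigma^*$. Let $P(\lambda)=1$, $P(u\sigma)=P(u)\,\mathcal L(u)(\sigma)$; the string $u$ is *defined* if $P(u)>0$. Let $E$ be any equivalence relation on $\Delta(\Sigma_\$)$ whose equivalent elements have the same support, written $=_E$. Write $u\equiv v$ if $u,v$ are both defined or both undefined, and $\mathcal L(uw)=_E\mathcal L(vw)$ for all $w\in\Sigma^*$ such that $uw$ and $vw$ are defined. This is an equivalence relation compatible with appending symbols, and all undefined strings form one class $\mathbf 0$. The quotient $\overline{\mathcal A}$ has the classes $[u]\ne\mathbf 0$ as states and $[\lambda]$ as initial state;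 $\tau([u],\sigma)=[u\sigma]$ if $u\sigma$ is defined, and otherwise (where the class is $\mathbf 0$) the transition is undefined; and $\pi(c)=\mathcal L(\alpha(c))$, where $\alpha(c)\in c$ is a chosen access string of $c$ and $\alpha([\lambda])=\lambda$. In an automaton with partial transitions a string is defined if it labels a path of transitions of positive probability. *The algorithm Omit-Zero* learns $\mathcal A$ from two kinds of queries. A membership query $u$ is answered by $\mathcal L(u)$ if $u$ is defined, and by "undefined" otherwise; let $\ell(u)$ be the $E$-class of $\mathcal L(u)$ if $u$ is defined, and $\ell(u)=\text{undefined}$ otherwise. An equivalence query for a hypothesis $\mathcal H$ is answered by any counterexample, i.e. any string $\gamma$ that is defined in $\mathcal H$ and satisfies $\mathcal L(\gamma)\ne_E\mathcal H(\gamma)$, or by $\bot$ if there is none. The algorithm keeps a tree $T$ whose leaves are access strings, whose inner nodes are distinguishing strings, and whose arcs from a node carry pairwise different values of $\ell$. Sifting $x$ means descending from the root, at a node $w$ along the arc labelled $\ell(xw)$. 1. Ask an equivalence query for the one-state hypothesis with distribution $\mathcal L(\lambda)$ and a loop for each $\sigma\in\mathsf{supp}(\mathcal L(\lambda))$. If the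 answer is $\bot$, return this hypothesis. If the answer is $\gamma$, let $x$ be the shortest prefix of $\gamma$ that is a counterexample, and let $T$ have root $\lambda$ and the two leaves $\lambda$ (along the arc $\ell(\lambda)$) and $x$ (along the arc $\ell(x)$). 2. (Build.) As long as there are a leaf $u$ and $\sigma\in\mathsf{supp}(\mathcal L(u))$ such that sifting $u\sigma$ meets a missing arc, add that arc and the leaf $u\sigma$ at its end (in any order). Then let $\mathcal H$ have a state $q_u$ with distribution $\mathcal L(u)$ for each leaf $u$, the initial state $q_\lambda$, and $\tau(q_u,\sigma)=q_{u'}$ with $u'$ the leaf to which $u\sigma$ is sifted if $\sigma\in\mathsf{supp}(\mathcal L(u))$; $\tau(q_u,\sigma)$ is undefined otherwise. 3. Ask an equivalence query for $\mathcal H$. If the answer is $\bot$, return $\mathcal H$. If the answer is $\gamma$, find the shortest prefix $x\sigma$ of $\gamma$ that is not sifted to the leaf $v$ whose state $\mathcal H$ reaches on $x\sigma$; let $w$ be the node at which the sifting paths of $x\sigma$ and $v$ separate; replace the leaf $u$ to which $x$ is sifted by an inner node $\sigma w$ with the two leaves $u$ (along $\ell(u\sigma w)$) and $x$ (along $\ell(x\sigma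 w)$). Go to 2. **Proposition.** For every PDFA $\mathcal A$ and every such $E$, whatever counterexamples the teacher chooses and in whatever order leaves are added, Omit-Zero terminates: no run is infinite, and no run gets stuck before it returns an automaton. Every returned automaton is isomorphic to the quotient $\overline{\mathcal A}$ (for some choice $\alpha$ of access strings). In particular it is finite, it is $\equiv$-equivalent to $\mathcal A$ (the same strings are defined, and on these the next-symbol distributions are $E$-equivalent), and it has the least number of states among all automata, with total or partial transitions, that are $\equiv$-equivalent to $\mathcal A$. -/

import Mathlib

open scoped Classical

namespace OmitZero

/-! ### Language models, supports, defined strings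

`S` is the finite alphabet, strings are `List S`, and `Option S` is the alphabet extended by the
termination symbol, which is `none`. -/

/-- The probability simplex over the alphabet extended by the termination symbol. -/
abbrev Dist (S : Type*) [Fintype S] : Type _ := stdSimplex ℝ (Option S)

/-- The symbols of positive probability. -/
def supp {S : Type*} [Fintype S] (ρ : Dist S) : Set S := {σ | 0 < ρ.1 (some σ)}

/-- A language model: a total map from strings to next-symbol distributions. -/
abbrev LanguageModel (S : Type*) [Fintype S] : Type _ := List S → Dist S

/-- `probAfter L u w` is the probability of reading `w` after `u`. -/
def probAfter {S : Type*} [Fintype S] (L : LanguageModel S) : List S → List S → ℝ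
  | _, [] => 1
  | u, σ :: w => (L u).1 (some σ) * probAfter L (u ++ [σ]) w

/-- The prefix probability of a string. -/
def prefixProb {S : Type*} [Fintype S] (L : LanguageModel S) (w : List S) : ℝ :=
  probAfter L [] w

/-- A string is defined if its prefix probability is positive. -/
def IsDef {S : Type*} [Fintype S] (L : LanguageModel S) (u : List S) : Prop :=
  0 < prefixProb L u

theorem probAfter_append_singleton {S : Type*} [Fintype S] (L : LanguageModel S)
    (u w : List S) (σ : S) :
    probAfter L u (w ++ [σ]) = probAfter L u w * (L (u ++ w)).1 (some σ) := by
  induction w generalizing u with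
  | nil => simp [probAfter]
  | cons a w ih => simp [probAfter, ih, mul_assoc]

theorem prefixProb_nil {S : Type*} [Fintype S] (L : LanguageModel S) : prefixProb L [] = 1 := rfl

theorem prefixProb_append_singleton {S : Type*} [Fintype S] (L : LanguageModel S)
    (u : List S) (σ : S) :
    prefixProb L (u ++ [σ]) = prefixProb L u * (L u).1 (some σ) := by
  simpa [prefixProb] using probAfter_append_singleton L [] u σ

theorem prefixProb_nonneg {S : Type*} [Fintype S] (L : LanguageModel S) (u : List S) :
    0 ≤ prefixProb L u := by
  induction u using List.reverseRecOn with
  | nil => simp [prefixProb_nil]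
  | append_singleton u σ ih =>
    rw [prefixProb_append_singleton]
    exact mul_nonneg ih ((L u).2.1 _)

theorem isDef_nil {S : Type*} [Fintype S] (L : LanguageModel S) : IsDef L [] := by
  simp [IsDef, prefixProb_nil]

theorem isDef_append_singleton {S : Type*} [Fintype S] (L : LanguageModel S)
    (u : List S) (σ : S) : IsDef L (u ++ [σ]) ↔ IsDef L u ∧ σ ∈ supp (L u) := by
  have h1 := prefixProb_nonneg L u
  have h2 : 0 ≤ (L u).1 (some σ) := (L u).2.1 _
  simp only [IsDef, prefixProb_append_singleton, supp, Set.mem_ofPred_eq]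
  constructor
  · intro h
    exact ⟨pos_of_mul_pos_left h h2, pos_of_mul_pos_right h h1⟩
  · rintro ⟨h, h'⟩
    exact mul_pos h h'

/-! ### The congruence -/

/-- An equivalence relation on distributions whose equivalent elements have the same support. -/
structure SuppEquiv (S : Type*) [Fintype S] where
  rel : Setoid (Dist S)
  supp_eq : ∀ ρ ρ' : Dist S, rel ρ ρ' → supp ρ = supp ρ'

/-- The relation on strings: both undefined, or both defined with equivalent next-symbol
distributions after every common defined continuation. -/
def Cong {S : Type*} [Fintype S] (E : SuppEquiv S) (L : LanguageModel S) (u v : List S) : Prop :=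
  (IsDef L u ↔ IsDef L v) ∧
    ∀ w : List S, IsDef L (u ++ w) → IsDef L (v ++ w) → E.rel (L (u ++ w)) (L (v ++ w))

theorem Cong.symm {S : Type*} [Fintype S] {E : SuppEquiv S} {L : LanguageModel S}
    {u v : List S} (h : Cong E L u v) : Cong E L v u :=
  ⟨h.1.symm, fun w hu hv => E.rel.symm' (h.2 w hv hu)⟩

theorem Cong.isDef_append {S : Type*} [Fintype S] {E : SuppEquiv S} {L : LanguageModel S}
    {u v : List S} (h : Cong E L u v) (w : List S) (hu : IsDef L (u ++ w)) :
    IsDef L (v ++ w) := by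
  induction w using List.reverseRecOn with
  | nil => simpa using h.1.1 (by simpa using hu)
  | append_singleton w σ ih =>
    rw [← List.append_assoc, isDef_append_singleton] at hu ⊢
    have hv := ih hu.1
    refine ⟨hv, ?_⟩
    rw [← E.supp_eq _ _ (h.2 w hu.1 hv)]
    exact hu.2

/-- The congruence as an equivalence relation on strings. -/
def congSetoid {S : Type*} [Fintype S] (E : SuppEquiv S) (L : LanguageModel S) :
    Setoid (List S) where
  r := Cong E L
  iseqv :=
    { refl := fun _ => ⟨Iff.rfl, fun _ _ _ => E.rel.refl' _⟩
      symm := fun h => h.symm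
      trans := fun h h' => ⟨h.1.trans h'.1, fun x hu hw =>
        E.rel.trans' (h.2 x hu (h.isDef_append x hu)) (h'.2 x (h.isDef_append x hu) hw)⟩ }

theorem Cong.append_singleton {S : Type*} [Fintype S] {E : SuppEquiv S} {L : LanguageModel S}
    {u v : List S} (h : Cong E L u v) (σ : S) : Cong E L (u ++ [σ]) (v ++ [σ]) := by
  refine ⟨⟨h.isDef_append [σ], h.symm.isDef_append [σ]⟩, fun w hu hv => ?_⟩
  rw [List.append_assoc] at hu hv ⊢
  rw [List.append_assoc]
  exact h.2 _ hu hv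

/-- Congruence classes of strings. -/
abbrev StrClass {S : Type*} [Fintype S] (E : SuppEquiv S) (L : LanguageModel S) : Type _ :=
  Quotient (congSetoid E L)

/-- Appending a symbol to a class. -/
def StrClass.step {S : Type*} [Fintype S] {E : SuppEquiv S} {L : LanguageModel S}
    (c : StrClass E L) (σ : S) : StrClass E L :=
  Quotient.map (sa := congSetoid E L) (sb := congSetoid E L) (fun u => u ++ [σ])
    (fun _ _ h => Cong.append_singleton h σ) c

/-- A class is defined if its strings are; all undefined strings form one single class. -/
def StrClass.IsDef {S : Type*} [Fintype S] {E : SuppEquiv S} {L : LanguageModel S}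
    (c : StrClass E L) : Prop :=
  Quotient.lift (s := congSetoid E L) (fun u => OmitZero.IsDef L u)
    (fun u v h => propext (show Cong E L u v from h).1) c

/-- The classes of defined strings. -/
abbrev DefClass {S : Type*} [Fintype S] (E : SuppEquiv S) (L : LanguageModel S) : Type _ :=
  {c : StrClass E L // c.IsDef}

/-! ### Automata -/

/-- A probabilistic deterministic finite automaton (finiteness of `Q` is assumed where used). -/
structure PDFA (S Q : Type*) [Fintype S] where
  init : Q
  policy : Q → Dist S
  trans : Q → S → Q

/-- The language model of a PDFA. -/
def PDFA.model {S Q : Type*} [Fintype S] (A : PDFA S Q) : LanguageModel S :=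
  fun u => A.policy (u.foldl A.trans A.init)

/-- A PDFA whose transitions may be undefined (`none`). -/
structure PartialPDFA (S Q : Type*) [Fintype S] where
  init : Q
  policy : Q → Dist S
  trans : Q → S → Option Q

namespace PartialPDFA

/-- The state reached from `q` along positive-probability transitions, if the string is defined. -/
noncomputable def runFrom {S Q : Type*} [Fintype S] (B : PartialPDFA S Q) : Q → List S → Option Q
  | q, [] => some q
  | q, σ :: w =>
    if σ ∈ supp (B.policy q) then (B.trans q σ).bind fun q' => B.runFrom q' w else none

/-- The state reached by a string that is defined in `B`; `none` if the string is undefined. -/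
noncomputable def run {S Q : Type*} [Fintype S] (B : PartialPDFA S Q) (u : List S) : Option Q :=
  B.runFrom B.init u

/-- `B` is equivalent to `L`: the same strings are defined, and on these the next-symbol
distributions are equivalent. -/
def EquivTo {S Q : Type*} [Fintype S] (B : PartialPDFA S Q) (E : SuppEquiv S)
    (L : LanguageModel S) : Prop :=
  ∀ u : List S, (IsDef L u ↔ ∃ q, B.run u = some q) ∧
    ∀ q, B.run u = some q → E.rel (L u) (B.policy q)

/-- Isomorphism of automata. -/
def Iso {S Q Q' : Type*} [Fintype S] (B : PartialPDFA S Q) (B' : PartialPDFA S Q') : Prop :=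
  ∃ f : Q ≃ Q', f B.init = B'.init ∧ (∀ q, B'.policy (f q) = B.policy q) ∧
    ∀ q σ, B'.trans (f q) σ = (B.trans q σ).map f

end PartialPDFA

/-- A choice of access strings, one in every defined class, the empty one for the initial class. -/
structure AccessChoice {S : Type*} [Fintype S] (E : SuppEquiv S) (L : LanguageModel S) where
  access : DefClass E L → List S
  access_mem : ∀ c, (⟦access c⟧ : StrClass E L) = c.1
  access_init : access ⟨⟦[]⟧, isDef_nil L⟩ = []

/-- The quotient automaton for a choice of access strings. Its states are the classes of defined
strings; a transition into the class of the undefined strings is an undefined transition. -/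
noncomputable def quotientPDFA {S Q : Type*} [Fintype S] (A : PDFA S Q) (E : SuppEquiv S)
    (α : AccessChoice E A.model) : PartialPDFA S (DefClass E A.model) where
  init := ⟨⟦[]⟧, isDef_nil A.model⟩
  policy c := A.model (α.access c)
  trans c σ := if h : (c.1.step σ).IsDef then some ⟨c.1.step σ, h⟩ else none

/-! ### The tree -/

/-- Answer to a membership query, up to equivalence: the class of the next-symbol distribution
of a defined string, and `none` (undefined) for an undefined string. -/
noncomputable def label {S : Type*} [Fintype S] (E : SuppEquiv S) (L : LanguageModel S)
    (u : List S) : Option (Quotient E.rel) :=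
  if IsDef L u then some (Quotient.mk E.rel (L u)) else none

/-- Classification trees: leaves carry access strings, inner nodes carry distinguishing strings,
and the arcs leaving a node carry pairwise different labels of type `K`; `empty` stands for the
absence of an arc. -/
inductive Tree (S : Type*) (K : Type*) where
  | empty : Tree S K
  | leaf (u : List S) : Tree S K
  | node (w : List S) (child : K → Tree S K) : Tree S K

namespace Tree

/-- The set of access strings. -/
def acc {S K : Type*} : Tree S K → Set (List S)
  | empty => ∅
  | leaf u => {u}
  | node _ child => ⋃ k, (child k).acc

/-- Descend from the root, at a node `w` along the arc with the label of `x ++ w`; the result is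
the leaf that is reached, or `none` if an arc is missing. -/
def sift {S K : Type*} (lab : List S → K) : Tree S K → List S → Option (List S)
  | empty, _ => none
  | leaf u, _ => some u
  | node w child, x => (child (lab (x ++ w))).sift lab x

/-- Add `x` as a new leaf at the place where an arc is missing when `x` is sifted. -/
noncomputable def siftUpdate {S K : Type*} (lab : List S → K) : Tree S K → List S → Tree S K
  | empty, x => leaf x
  | leaf u, _ => leaf u
  | node w child, x =>
    node w (Function.update child (lab (x ++ w)) ((child (lab (x ++ w))).siftUpdate lab x))

/-- The lowest common ancestor of the places to which `x` and `y` are sifted, that is, the node at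
which they take different arcs; `none` if they take the same arcs all the way. -/
noncomputable def lca {S K : Type*} (lab : List S → K) :
    Tree S K → List S → List S → Option (List S)
  | empty, _, _ => none
  | leaf _, _, _ => none
  | node w child, x, y =>
    if lab (x ++ w) = lab (y ++ w) then (child (lab (x ++ w))).lca lab x y else some w

/-- An inner node `d` with two leaves `u` and `x`. -/
noncomputable def fork {S K : Type*} (lab : List S → K) (d u x : List S) : Tree S K :=
  node d (Function.update (Function.update (fun _ => empty) (lab (u ++ d)) (leaf u))
    (lab (x ++ d)) (leaf x))

/-- Replace the leaf `u` to which `x` is sifted by an inner node `d` with leaves `u` and `x`. -/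
noncomputable def split {S K : Type*} (lab : List S → K) (d : List S) :
    Tree S K → List S → Tree S K
  | empty, _ => empty
  | leaf u, x => fork lab d u x
  | node w child, x =>
    node w (Function.update child (lab (x ++ w)) ((child (lab (x ++ w))).split lab d x))

theorem mem_acc_of_sift {S K : Type*} (lab : List S → K) (T : Tree S K) (x u : List S)
    (h : T.sift lab x = some u) : u ∈ T.acc := by
  induction T with
  | empty => simp [sift] at h
  | leaf v => simpa [sift, acc, eq_comm] using h
  | node w child ih => exact Set.mem_iUnion.2 ⟨_, ih _ h⟩

end Tree

/-! ### The algorithm -/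

/-- A hypothesis: an automaton whose states are access strings. -/
structure Hypothesis (S : Type*) [Fintype S] where
  acc : Set (List S)
  aut : PartialPDFA S acc

/-- The one-state hypothesis, with a loop for every symbol of positive probability. -/
noncomputable def initialHypothesis {S : Type*} [Fintype S] (L : LanguageModel S) :
    Hypothesis S where
  acc := {[]}
  aut :=
    { init := ⟨[], rfl⟩
      policy := fun u => L u.1
      trans := fun u σ => if σ ∈ supp (L u.1) then some u else none }

/-- The hypothesis of a tree: the states are the leaves, and the successor of `u` under a symbol
`σ` of positive probability is the leaf to which `u ++ [σ]` is sifted. -/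
noncomputable def build {S : Type*} [Fintype S] (E : SuppEquiv S) (L : LanguageModel S)
    (T : Tree S (Option (Quotient E.rel))) (h : [] ∈ T.acc) : Hypothesis S where
  acc := T.acc
  aut :=
    { init := ⟨[], h⟩
      policy := fun u => L u.1
      trans := fun u σ =>
        if σ ∈ supp (L u.1) then
          (T.sift (label E L) (u.1 ++ [σ])).pmap (fun v hv => ⟨v, hv⟩)
            (fun _ hv => T.mem_acc_of_sift (label E L) _ _ hv)
        else none }

/-- `γ` is a counterexample to `H`: it is defined in `H`, and its next-symbol distributions
in `L` and in `H` are not equivalent. -/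
def IsCounterexample {S : Type*} [Fintype S] (E : SuppEquiv S) (L : LanguageModel S)
    (H : Hypothesis S) (γ : List S) : Prop :=
  ∃ q, H.aut.run γ = some q ∧ ¬ E.rel (L γ) (H.aut.policy q)

/-- The initial tree: the root is the empty distinguishing string, and the leaves are the empty
string and `x`. -/
noncomputable def initialTree {S : Type*} [Fintype S] (E : SuppEquiv S) (L : LanguageModel S)
    (x : List S) : Tree S (Option (Quotient E.rel)) :=
  Tree.fork (label E L) [] [] x

/-- Configurations of the algorithm: before the first equivalence query, in the main loop with
the current tree, and after an automaton has been returned. -/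
inductive Config (S : Type*) [Fintype S] (E : SuppEquiv S) where
  | start : Config S E
  | loop (T : Tree S (Option (Quotient E.rel))) : Config S E
  | done (H : Hypothesis S) : Config S E

/-- The steps of the algorithm on the target `L`. The teacher may answer an equivalence query by
any counterexample, and says that there is none exactly if there is none. -/
inductive Step {S : Type*} [Fintype S] (E : SuppEquiv S) (L : LanguageModel S) :
    Config S E → Config S E → Prop
  /-- The initial hypothesis has no counterexample and is returned. -/
  | initReturn (h : ∀ γ, ¬ IsCounterexample E L (initialHypothesis L) γ) :
      Step E L .start (.done (initialHypothesis L))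
  /-- The teacher answers by `γ`; its shortest prefix `x` that is a counterexample becomes
  an access string. -/
  | initTree (γ x : List S) (hγ : IsCounterexample E L (initialHypothesis L) γ) (hx : x <+: γ)
      (hbad : IsCounterexample E L (initialHypothesis L) x)
      (hmin : ∀ y, y <+: x → y ≠ x → ¬ IsCounterexample E L (initialHypothesis L) y) :
      Step E L .start (.loop (initialTree E L x))
  /-- While the automaton is built, sifting `u ++ [σ]` meets a missing arc, and a leaf is added. -/
  | siftNew (T : Tree S (Option (Quotient E.rel))) (u : List S) (σ : S) (hu : u ∈ T.acc)
      (hσ : σ ∈ supp (L u)) (hs : T.sift (label E L) (u ++ [σ]) = none) :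
      Step E L (.loop T) (.loop (T.siftUpdate (label E L) (u ++ [σ])))
  /-- The automaton is complete, has no counterexample, and is returned. -/
  | loopReturn (T : Tree S (Option (Quotient E.rel))) (h0 : [] ∈ T.acc)
      (hT : ∀ u ∈ T.acc, ∀ σ ∈ supp (L u), T.sift (label E L) (u ++ [σ]) ≠ none)
      (h : ∀ γ, ¬ IsCounterexample E L (build E L T h0) γ) :
      Step E L (.loop T) (.done (build E L T h0))
  /-- The automaton is complete and the teacher answers by `γ`. Let `x ++ [σ]` be the shortest
  prefix of `γ` that is not sifted to the state `q` that it reaches in the automaton, and `w` the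
  lowest common ancestor. The leaf to which `x` is sifted is split by `σ :: w`. -/
  | update (T : Tree S (Option (Quotient E.rel))) (h0 : [] ∈ T.acc)
      (hT : ∀ u ∈ T.acc, ∀ σ ∈ supp (L u), T.sift (label E L) (u ++ [σ]) ≠ none)
      (γ : List S) (hγ : IsCounterexample E L (build E L T h0) γ)
      (x : List S) (σ : S) (hx : x ++ [σ] <+: γ)
      (hagree : ∀ y, y <+: x →
        ∃ p, (build E L T h0).aut.run y = some p ∧ T.sift (label E L) y = some p.1)
      (q : (build E L T h0).acc) (hq : (build E L T h0).aut.run (x ++ [σ]) = some q)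
      (w : List S) (hw : T.lca (label E L) (x ++ [σ]) q.1 = some w) :
      Step E L (.loop T) (.loop (T.split (label E L) (σ :: w) x))

end OmitZero

/-! The proof rests on counting leaves against the classes of defined strings. These classes are
finite in number, since the state of `A` reached by a defined string determines its class
(`finite_defClass`).

In the loop every leaf is a defined string lying below the arcs that carry its labels, and the root
is the empty distinguishing string (`TreeInv`). Congruent strings have equal labels after every
continuation, so they are sifted alike; hence distinct leaves are incongruent and inject into the
classes. A step that stays in the loop adds a leaf (`step_loop`), which gives termination.

For progress, a counterexample cannot be sifted to the state it reaches, because the root compares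
distributions. So there is a shortest badly sifted prefix `x ++ [σ]`. Here `x` is sifted to the leaf
`p` that it reaches, and `σ :: w` separates `x` from `p` (`label_ne_of_lca`).

A hypothesis without counterexample is equivalent to the target, as equal supports force the same
defined strings. An equivalent automaton has at least one state per class
(`EquivTo.exists_injective`), so the states of the hypothesis are exactly the classes. This yields
both the isomorphism and minimality. -/

namespace OmitZero

/-! ### Classification trees: sifting, separation and new leaves -/

namespace Tree

variable {S K : Type*} {lab : List S → K}

/-- Every leaf lies below the arcs that carry its labels. -/
def Consistent (lab : List S → K) : Tree S K → Prop
  | empty => True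
  | leaf _ => True
  | node w child => ∀ k, (child k).Consistent lab ∧ ∀ u ∈ (child k).acc, lab (u ++ w) = k

theorem mem_acc_node {w : List S} {child : K → Tree S K} {u : List S} :
    u ∈ (node w child).acc ↔ ∃ k, u ∈ (child k).acc := Set.mem_iUnion

theorem Consistent.sift_eq_self {T : Tree S K} (hT : T.Consistent lab) {u : List S}
    (hu : u ∈ T.acc) : T.sift lab u = some u := by
  induction T with
  | empty => exact hu.elim
  | leaf v => rw [show u = v from hu]; rfl
  | node w child ih =>
    obtain ⟨k, hk⟩ := mem_acc_node.1 hu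
    simp only [sift, (hT k).2 u hk]
    exact ih k (hT k).1 hk

/-- Sifting sees a string only through its labels; the hypothesis will be supplied by congruence. -/
theorem sift_congr {T : Tree S K} {x y : List S} (h : ∀ w, lab (x ++ w) = lab (y ++ w)) :
    T.sift lab x = T.sift lab y := by
  induction T with
  | empty => rfl
  | leaf v => rfl
  | node w child ih => simp only [sift, h w]; exact ih _

theorem sift_eq_of_lca_eq_none {T : Tree S K} {x y : List S} (h : T.lca lab x y = none) :
    T.sift lab x = T.sift lab y := by
  induction T with
  | empty => rfl
  | leaf v => rfl
  | node w child ih =>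
    by_cases hk : lab (x ++ w) = lab (y ++ w)
    · simp only [lca, if_pos hk] at h
      simp only [sift, ← hk]
      exact ih _ h
    · simp [lca, hk] at h

theorem label_ne_of_lca_eq_some {T : Tree S K} {x y w : List S} (h : T.lca lab x y = some w) :
    lab (x ++ w) ≠ lab (y ++ w) := by
  induction T with
  | empty => simp [lca] at h
  | leaf v => simp [lca] at h
  | node d child ih =>
    by_cases hk : lab (x ++ d) = lab (y ++ d)
    · simp only [lca, if_pos hk] at h
      exact ih _ h
    · simp only [lca, if_neg hk, Option.some.injEq] at h
      exact h ▸ hk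

/-- A string that is sifted to the leaf `q` has the labels of `q` along the path to `q`. -/
theorem Consistent.label_eq_of_lca_eq_some {T : Tree S K} (hT : T.Consistent lab)
    {x z q w : List S} (hz : T.sift lab z = some q) (h : T.lca lab x q = some w) :
    lab (z ++ w) = lab (q ++ w) := by
  induction T with
  | empty => simp [lca] at h
  | leaf v => simp [lca] at h
  | node d child ih =>
    simp only [sift] at hz
    -- The leaf `q` lies below the arc that `z` takes, so consistency gives it the label of `z`.
    have hq : lab (q ++ d) = lab (z ++ d) := (hT _).2 q (mem_acc_of_sift lab _ _ _ hz)
    by_cases hk : lab (x ++ d) = lab (q ++ d)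
    · simp only [lca, if_pos hk] at h
      rw [hk, hq] at h
      exact ih _ (hT _).1 hz h
    · simp only [lca, if_neg hk, Option.some.injEq] at h
      exact h ▸ hq.symm

/-- Common core of `siftUpdate`, `fork` and `split`: each replaces one child by a tree with one more
leaf. -/
theorem acc_node_update {w x : List S} {child : K → Tree S K} {k : K} {T' : Tree S K}
    (h : T'.acc = insert x (child k).acc) :
    (node w (Function.update child k T')).acc = insert x (node w child).acc := by
  ext u
  rw [Set.mem_insert_iff, mem_acc_node, mem_acc_node]
  constructor
  · rintro ⟨j, hj⟩
    by_cases hjk : j = k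
    · subst hjk
      rw [Function.update_self, h] at hj
      exact hj.imp id fun hj => ⟨_, hj⟩
    · rw [Function.update_of_ne hjk] at hj
      exact .inr ⟨j, hj⟩
  · rintro (rfl | ⟨j, hj⟩)
    · exact ⟨k, by rw [Function.update_self, h]; exact Set.mem_insert _ _⟩
    · refine ⟨j, ?_⟩
      by_cases hjk : j = k
      · subst hjk
        rw [Function.update_self, h]
        exact Set.mem_insert_of_mem _ hj
      · rwa [Function.update_of_ne hjk]

/-- The only new leaf below this arc is `x`, and the arc is the one chosen by the label of `x`. -/
theorem Consistent.node_update {w x : List S} {child : K → Tree S K} {T' : Tree S K}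
    (hT : (node w child).Consistent lab) (hT' : T'.Consistent lab)
    (h : T'.acc = insert x (child (lab (x ++ w))).acc) :
    (node w (Function.update child (lab (x ++ w)) T')).Consistent lab := by
  intro j
  by_cases hj : j = lab (x ++ w)
  · subst hj
    rw [Function.update_self]
    refine ⟨hT', fun u hu => ?_⟩
    rw [h] at hu
    rcases hu with rfl | hu
    · rfl
    · exact (hT _).2 u hu
  · rw [Function.update_of_ne hj]
    exact hT j

theorem acc_siftUpdate {T : Tree S K} {x : List S} (h : T.sift lab x = none) :
    (T.siftUpdate lab x).acc = insert x T.acc := by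
  induction T with
  | empty => simp [siftUpdate, acc]
  | leaf v => simp [sift] at h
  | node w child ih => exact acc_node_update (ih _ h)

theorem Consistent.siftUpdate {T : Tree S K} (hT : T.Consistent lab) {x : List S}
    (h : T.sift lab x = none) : (T.siftUpdate lab x).Consistent lab := by
  induction T with
  | empty => trivial
  | leaf v => trivial
  | node w child ih => exact hT.node_update (ih _ (hT _).1 h) (acc_siftUpdate h)

/-- With equal labels the second update would overwrite the leaf `u`. -/
theorem acc_fork {d u x : List S} (h : lab (u ++ d) ≠ lab (x ++ d)) :
    (fork lab d u x).acc = insert x {u} := by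
  have h1 : (node d (Function.update (fun _ => empty) (lab (u ++ d)) (leaf u))).acc = {u} := by
    rw [acc_node_update (x := u) (by simp [acc])]
    simp [acc]
  rw [fork, acc_node_update (x := x), h1]
  rw [Function.update_of_ne h.symm]
  simp [acc]

theorem consistent_fork {d u x : List S} (h : lab (u ++ d) ≠ lab (x ++ d)) :
    (fork lab d u x).Consistent lab := by
  refine Consistent.node_update (Consistent.node_update (fun k => ⟨trivial, ?_⟩) trivial ?_)
    trivial ?_
  · simp [acc]
  · simp [acc]
  · rw [Function.update_of_ne h.symm]
    simp [acc]

theorem acc_split {T : Tree S K} {d x u : List S} (hu : T.sift lab x = some u)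
    (h : lab (u ++ d) ≠ lab (x ++ d)) : (T.split lab d x).acc = insert x T.acc := by
  induction T with
  | empty => simp [sift] at hu
  | leaf v =>
    simp only [sift, Option.some.injEq] at hu
    subst hu
    exact acc_fork h
  | node w child ih => exact acc_node_update (ih _ hu)

theorem Consistent.split {T : Tree S K} (hT : T.Consistent lab) {d x u : List S}
    (hu : T.sift lab x = some u) (h : lab (u ++ d) ≠ lab (x ++ d)) :
    (T.split lab d x).Consistent lab := by
  induction T with
  | empty => trivial
  | leaf v =>
    simp only [sift, Option.some.injEq] at hu
    subst hu
    exact consistent_fork h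
  | node w child ih => exact hT.node_update (ih _ (hT _).1 hu) (acc_split hu h)

/-- At the root `[]` the arc taken is the label of the string itself, so it is shared with the leaf
reached. -/
theorem Consistent.label_eq_of_sift {child : K → Tree S K} (hT : (node [] child).Consistent lab)
    {x u : List S} (h : (node [] child).sift lab x = some u) : lab x = lab u := by
  simp only [sift, List.append_nil] at h
  simpa using ((hT _).2 u (mem_acc_of_sift lab _ _ _ h)).symm

end Tree

/-- A shortest prefix with a given property. -/
theorem exists_minimal_prefix {α : Type*} {P : List α → Prop} {γ : List α} (h : P γ) :
    ∃ x, x <+: γ ∧ P x ∧ ∀ y, y <+: x → y ≠ x → ¬ P y := by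
  induction hn : γ.length using Nat.strong_induction_on generalizing γ with
  | _ n ih =>
    by_cases h' : ∀ y, y <+: γ → y ≠ γ → ¬ P y
    · exact ⟨γ, List.prefix_rfl, h, h'⟩
    · push Not at h'
      obtain ⟨y, hy, hne, hPy⟩ := h'
      have hlt : y.length < n := hn ▸ lt_of_le_of_ne hy.length_le fun h => hne (hy.eq_of_length h)
      obtain ⟨x, hx, hx'⟩ := ih _ hlt hPy rfl
      exact ⟨x, hx.trans hy, hx'⟩

/-! ### Labels and the congruence -/

variable {S : Type*} [Fintype S] {E : SuppEquiv S} {L : LanguageModel S}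

theorem label_eq_some {u : List S} (h : IsDef L u) : label E L u = some (Quotient.mk E.rel (L u)) :=
  if_pos h

theorem isDef_of_label_eq {u v : List S} (hv : IsDef L v) (h : label E L u = label E L v) :
    IsDef L u := by
  by_contra hu
  rw [label_eq_some hv, label, if_neg hu] at h
  cases h

theorem rel_of_label_eq {u v : List S} (hv : IsDef L v) (h : label E L u = label E L v) :
    E.rel (L u) (L v) := by
  have hu := isDef_of_label_eq hv h
  rw [label_eq_some hv, label_eq_some hu] at h
  exact Quotient.exact (Option.some.inj h)

/-- Congruent strings have the same defined continuations because `E` respects supports; hence no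
distinguishing string separates them. -/
theorem Cong.label_eq {u v : List S} (h : Cong E L u v) (w : List S) :
    label E L (u ++ w) = label E L (v ++ w) := by
  by_cases hu : IsDef L (u ++ w)
  · have hv := h.isDef_append w hu
    rw [label_eq_some hu, label_eq_some hv]
    exact congrArg some (Quotient.sound (h.2 w hu hv))
  · have hv : ¬ IsDef L (v ++ w) := fun hv => hu (h.symm.isDef_append w hv)
    rw [label, label, if_neg hu, if_neg hv]

/-! ### Runs and equivalence of partial automata -/

namespace PartialPDFA

variable {Q : Type*} (B : PartialPDFA S Q)

theorem runFrom_append (q : Q) (u w : List S) :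
    B.runFrom q (u ++ w) = (B.runFrom q u).bind fun p => B.runFrom p w := by
  induction u generalizing q with
  | nil => rfl
  | cons σ u ih =>
    simp only [List.cons_append, runFrom]
    split_ifs
    · cases B.trans q σ with
      | none => rfl
      | some p => exact ih p
    · rfl

theorem run_append (u w : List S) :
    B.run (u ++ w) = (B.run u).bind fun p => B.runFrom p w := B.runFrom_append _ _ _

theorem runFrom_singleton (q : Q) (σ : S) :
    B.runFrom q [σ] = if σ ∈ supp (B.policy q) then B.trans q σ else none := by
  simp only [runFrom]
  split_ifs
  · cases B.trans q σ <;> rfl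
  · rfl

theorem run_append_singleton {u : List S} {p : Q} (h : B.run u = some p) (σ : S) :
    B.run (u ++ [σ]) = if σ ∈ supp (B.policy p) then B.trans p σ else none := by
  rw [run_append, h, Option.bind_some, runFrom_singleton]

variable {B}

theorem exists_run_of_prefix {u v : List S} (h : u <+: v) {q : Q} (hq : B.run v = some q) :
    ∃ p, B.run u = some p := by
  obtain ⟨w, rfl⟩ := h
  rw [run_append] at hq
  obtain ⟨p, hp, -⟩ := Option.bind_eq_some_iff.1 hq
  exact ⟨p, hp⟩

/-- After a common state all continuations run alike, so both distributions are compared with the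
same policy value. -/
theorem EquivTo.cong_of_run_eq (hB : B.EquivTo E L) {u v : List S} {q : Q}
    (hu : B.run u = some q) (hv : B.run v = some q) : Cong E L u v := by
  refine ⟨iff_of_true ((hB u).1.2 ⟨q, hu⟩) ((hB v).1.2 ⟨q, hv⟩), fun w huw _ => ?_⟩
  obtain ⟨p, hp⟩ := (hB _).1.1 huw
  have hp' : B.run (v ++ w) = some p := by rw [run_append, hv, ← hu, ← run_append, hp]
  exact E.rel.trans' ((hB _).2 p hp) (E.rel.symm' ((hB _).2 p hp'))

/-- An equivalent automaton has at least as many states as there are defined classes. -/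
theorem EquivTo.exists_injective (hB : B.EquivTo E L) :
    ∃ f : DefClass E L → Q, Function.Injective f := by
  have h : ∀ c : DefClass E L, ∃ q u, (⟦u⟧ : StrClass E L) = c.1 ∧ B.run u = some q := by
    rintro ⟨c, hc⟩
    induction c using Quotient.inductionOn with
    | h u =>
      obtain ⟨q, hq⟩ := (hB u).1.1 hc
      exact ⟨q, u, rfl, hq⟩
  choose f a ha hf using h
  refine ⟨f, fun c c' hcc => Subtype.ext ?_⟩
  rw [← ha c, ← ha c']
  exact Quotient.sound (hB.cong_of_run_eq (hf c) (by rw [hcc]; exact hf c'))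

/-- If the language model agrees with the automaton on the strings defined in the automaton, and
transitions of positive probability exist, then both are equivalent. -/
theorem equivTo_of_forall_run
    (htrans : ∀ q, ∀ σ ∈ supp (B.policy q), ∃ p, B.trans q σ = some p)
    (h : ∀ u q, B.run u = some q → E.rel (L u) (B.policy q)) : B.EquivTo E L := by
  refine fun u => ⟨?_, h u⟩
  induction u using List.reverseRecOn with
  | nil => exact iff_of_true (isDef_nil L) ⟨B.init, rfl⟩
  | append_singleton u σ ih =>
    rw [isDef_append_singleton, ih]
    constructor
    · rintro ⟨⟨q, hq⟩, hσ⟩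
      -- Equality of supports turns a symbol possible in `L` into one possible in `B`.
      rw [E.supp_eq _ _ (h u q hq)] at hσ
      rw [run_append_singleton B hq, if_pos hσ]
      exact htrans q σ hσ
    · rintro ⟨p, hp⟩
      obtain ⟨q, hq⟩ := exists_run_of_prefix (List.prefix_append u [σ]) hp
      refine ⟨⟨q, hq⟩, ?_⟩
      rw [run_append_singleton B hq] at hp
      rw [E.supp_eq _ _ (h u q hq)]
      by_contra hσ
      simp [hσ] at hp

end PartialPDFA

theorem finite_defClass {Q : Type*} [Finite Q] (A : PDFA S Q) (E : SuppEquiv S) :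
    Finite (DefClass E A.model) := by
  have h : ∀ c : DefClass E A.model, ∃ u, (⟦u⟧ : StrClass E A.model) = c.1 :=
    fun c => Quotient.exists_rep c.1
  choose a ha using h
  have hdef : ∀ c, IsDef A.model (a c) := fun c => by
    have := c.2
    rwa [← ha c] at this
  refine Finite.of_injective (fun c => (a c).foldl A.trans A.init) fun c c' hcc => Subtype.ext ?_
  rw [← ha c, ← ha c']
  refine Quotient.sound ⟨iff_of_true (hdef c) (hdef c'), fun w _ _ => ?_⟩
  have : A.model (a c ++ w) = A.model (a c' ++ w) := by
    simp only [PDFA.model, List.foldl_append]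
    exact congrArg (fun q => A.policy (w.foldl A.trans q)) hcc
  rw [this]

/-! ### Sound hypotheses and the quotient -/

/-- The properties shared by all hypotheses of the algorithm: the states are pairwise incongruent
defined strings, and a transition leads to the state that is congruent to the extended access
string, if there is such a state. -/
structure Hypothesis.Sound (E : SuppEquiv S) (L : LanguageModel S) (H : Hypothesis S) : Prop where
  init : H.aut.init.1 = []
  policy : ∀ u, H.aut.policy u = L u.1
  isDef : ∀ u ∈ H.acc, IsDef L u
  eq_of_cong : ∀ u ∈ H.acc, ∀ v ∈ H.acc, Cong E L u v → u = v
  trans_none : ∀ u σ, σ ∉ supp (L u.1) → H.aut.trans u σ = none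
  trans_some : ∀ u, ∀ σ ∈ supp (L u.1), ∃ v, H.aut.trans u σ = some v ∧
    ∀ v' ∈ H.acc, Cong E L (u.1 ++ [σ]) v' → v.1 = v'

namespace Hypothesis.Sound

variable {H : Hypothesis S}

/-- The class of an access string. -/
def toClass (hH : H.Sound E L) (u : H.acc) : DefClass E L := ⟨⟦u.1⟧, hH.isDef u.1 u.2⟩

theorem toClass_injective (hH : H.Sound E L) : Function.Injective hH.toClass := fun u v h =>
  Subtype.ext (hH.eq_of_cong u.1 u.2 v.1 v.2 (Quotient.exact (congrArg Subtype.val h)))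

theorem equivTo (hH : H.Sound E L) (h : ∀ γ, ¬ IsCounterexample E L H γ) :
    H.aut.EquivTo E L := by
  refine PartialPDFA.equivTo_of_forall_run (fun q σ hσ => ?_) fun u q hq => ?_
  · rw [hH.policy] at hσ
    obtain ⟨v, hv, -⟩ := hH.trans_some q σ hσ
    exact ⟨v, hv⟩
  · by_contra hne
    exact h u ⟨q, hq, hne⟩

/-- Finite sets with injections both ways: soundness maps states into classes, equivalence maps
classes into states. -/
theorem toClass_bijective [Finite (DefClass E L)] (hH : H.Sound E L)
    (h : H.aut.EquivTo E L) : Function.Bijective hH.toClass := by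
  have : Finite H.acc := Finite.of_injective _ hH.toClass_injective
  obtain ⟨f, hf⟩ := h.exists_injective
  exact (Nat.bijective_iff_injective_and_card _).2 ⟨hH.toClass_injective,
    le_antisymm (Nat.card_le_card_of_injective _ hH.toClass_injective)
      (Nat.card_le_card_of_injective _ hf)⟩

theorem exists_iso {Q : Type*} {A : PDFA S Q} (hH : H.Sound E A.model)
    (hbij : Function.Bijective hH.toClass) :
    ∃ α : AccessChoice E A.model, H.aut.Iso (quotientPDFA A E α) := by
  let e : H.acc ≃ DefClass E A.model := Equiv.ofBijective hH.toClass hbij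
  have hinit : e H.aut.init = ⟨⟦[]⟧, isDef_nil A.model⟩ :=
    Subtype.ext (congrArg (Quotient.mk (congSetoid E A.model)) hH.init)
  -- The chosen access string of a class is the unique state of `H` in it.
  refine ⟨⟨fun c => (e.symm c).1, fun c => congrArg Subtype.val (e.apply_symm_apply c), ?_⟩,
    e, hinit, fun q => ?_, fun q σ => ?_⟩
  · rw [← hinit, e.symm_apply_apply, hH.init]
  · change A.model (e.symm (e q)).1 = _
    rw [e.symm_apply_apply, hH.policy]
  · have hstep : ((e q).1.step σ).IsDef ↔ IsDef A.model (q.1 ++ [σ]) := Iff.rfl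
    rw [isDef_append_singleton] at hstep
    change (if h : ((e q).1.step σ).IsDef then some (⟨(e q).1.step σ, h⟩ : DefClass E A.model)
      else none) = _
    by_cases hσ : σ ∈ supp (A.model q.1)
    · have hd : ((e q).1.step σ).IsDef := hstep.2 ⟨hH.isDef _ q.2, hσ⟩
      rw [dif_pos hd]
      obtain ⟨v, hv, hv'⟩ := hH.trans_some q σ hσ
      -- Surjectivity provides a state in the target class, and soundness then forces the transition
      -- to lead there.
      obtain ⟨v₀, hv₀⟩ := e.surjective ⟨(e q).1.step σ, hd⟩
      have hc : (⟦v₀.1⟧ : StrClass E A.model) = ⟦q.1 ++ [σ]⟧ := congrArg Subtype.val hv₀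
      have hcong : Cong E A.model v₀.1 (q.1 ++ [σ]) := Quotient.exact hc
      have : v = v₀ := Subtype.ext (hv' v₀.1 v₀.2 hcong.symm)
      rw [hv, Option.map_some, this, hv₀]
    · rw [dif_neg fun h => hσ (hstep.1 h).2, hH.trans_none q σ hσ]
      rfl

end Hypothesis.Sound

/-- A loop may well leave its class, but the only state that `trans_some` could demand as target is
`[]`. -/
theorem sound_initialHypothesis : (initialHypothesis L).Sound E L where
  init := rfl
  policy _ := rfl
  isDef := by
    rintro u rfl
    exact isDef_nil L
  eq_of_cong := by
    rintro u rfl v rfl -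
    rfl
  trans_none u σ hσ := if_neg hσ
  trans_some u σ hσ := ⟨u, if_pos hσ, by
    rintro v' rfl -
    exact u.2⟩

/-! ### The tree invariant -/

/-- The invariant of the main loop. -/
structure TreeInv (E : SuppEquiv S) (L : LanguageModel S)
    (T : Tree S (Option (Quotient E.rel))) : Prop where
  root : ∃ child, T = .node [] child
  consistent : T.Consistent (label E L)
  nil_mem : [] ∈ T.acc
  isDef : ∀ u ∈ T.acc, IsDef L u

namespace TreeInv

variable {T : Tree S (Option (Quotient E.rel))}

theorem label_eq_of_sift (hT : TreeInv E L T) {x u : List S}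
    (h : T.sift (label E L) x = some u) : label E L x = label E L u := by
  obtain ⟨child, rfl⟩ := hT.root
  exact hT.consistent.label_eq_of_sift h

/-- Each leaf is sifted to itself, and congruent strings are sifted to the same place. -/
theorem eq_of_cong (hT : TreeInv E L T) {u v : List S} (hu : u ∈ T.acc) (hv : v ∈ T.acc)
    (h : Cong E L u v) : u = v :=
  Option.some.inj <| by
    rw [← hT.consistent.sift_eq_self hu, ← hT.consistent.sift_eq_self hv,
      Tree.sift_congr h.label_eq]

theorem finite_acc [Finite (DefClass E L)] (hT : TreeInv E L T) : T.acc.Finite :=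
  Set.finite_coe_iff.1 <| Finite.of_injective
    (fun u : T.acc => (⟨⟦u.1⟧, hT.isDef u.1 u.2⟩ : DefClass E L)) fun u v h =>
      Subtype.ext (hT.eq_of_cong u.2 v.2 (Quotient.exact (congrArg Subtype.val h)))

theorem ncard_acc_le [Finite (DefClass E L)] (hT : TreeInv E L T) :
    T.acc.ncard ≤ Nat.card (DefClass E L) :=
  Nat.card_le_card_of_injective
    (fun u : T.acc => (⟨⟦u.1⟧, hT.isDef u.1 u.2⟩ : DefClass E L)) fun u v h =>
      Subtype.ext (hT.eq_of_cong u.2 v.2 (Quotient.exact (congrArg Subtype.val h)))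

theorem siftUpdate (hT : TreeInv E L T) {x : List S} (hx : IsDef L x)
    (h : T.sift (label E L) x = none) : TreeInv E L (T.siftUpdate (label E L) x) where
  root := by
    obtain ⟨child, rfl⟩ := hT.root
    exact ⟨_, rfl⟩
  consistent := hT.consistent.siftUpdate h
  nil_mem := by
    rw [Tree.acc_siftUpdate h]
    exact .inr hT.nil_mem
  isDef := by
    rw [Tree.acc_siftUpdate h]
    rintro u (rfl | hu)
    exacts [hx, hT.isDef u hu]

theorem split (hT : TreeInv E L T) {d x u : List S} (hu : T.sift (label E L) x = some u)
    (h : label E L (u ++ d) ≠ label E L (x ++ d)) :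
    TreeInv E L (T.split (label E L) d x) where
  root := by
    obtain ⟨child, rfl⟩ := hT.root
    exact ⟨_, rfl⟩
  consistent := hT.consistent.split hu h
  nil_mem := by
    rw [Tree.acc_split hu h]
    exact .inr hT.nil_mem
  isDef := by
    rw [Tree.acc_split hu h]
    rintro v (rfl | hv)
    -- The root label of `x` is that of the defined leaf `u`, so no undefined string becomes a leaf.
    · exact isDef_of_label_eq (hT.isDef u (Tree.mem_acc_of_sift _ _ _ _ hu)) (hT.label_eq_of_sift hu)
    · exact hT.isDef v hv

theorem build_trans (h0 : [] ∈ T.acc) {u v : (build E L T h0).acc} {σ : S}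
    (hσ : σ ∈ supp (L u.1)) : (build E L T h0).aut.trans u σ = some v ↔
      T.sift (label E L) (u.1 ++ [σ]) = some v.1 := by
  refine (iff_of_eq (congrArg (· = some v) (if_pos hσ))).trans
    (Option.pmap_eq_some_iff.trans ?_)
  constructor
  · rintro ⟨a, h, ha, hv⟩
    rw [ha, hv]
  · intro h
    exact ⟨v.1, v.2, h, rfl⟩

theorem sound_build (hT : TreeInv E L T) (h0 : [] ∈ T.acc)
    (hc : ∀ u ∈ T.acc, ∀ σ ∈ supp (L u), T.sift (label E L) (u ++ [σ]) ≠ none) :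
    (build E L T h0).Sound E L where
  init := rfl
  policy _ := rfl
  isDef := hT.isDef
  eq_of_cong u hu v hv h := hT.eq_of_cong hu hv h
  trans_none u σ hσ := if_neg hσ
  trans_some u σ hσ := by
    obtain ⟨v, hv⟩ := Option.ne_none_iff_exists'.1 (hc u.1 u.2 σ hσ)
    refine ⟨⟨v, T.mem_acc_of_sift _ _ _ hv⟩, (build_trans h0 hσ).2 hv, fun v' hv' hcong => ?_⟩
    rw [Tree.sift_congr hcong.label_eq, hT.consistent.sift_eq_self hv', Option.some.injEq] at hv
    exact hv.symm

/-- The split that answers a counterexample separates two strings that were sifted to one leaf. -/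
theorem label_ne_of_lca (hT : TreeInv E L T) (h0 : [] ∈ T.acc) {x w : List S} {σ : S}
    {p q : (build E L T h0).acc} (hp : (build E L T h0).aut.run x = some p)
    (hq : (build E L T h0).aut.run (x ++ [σ]) = some q)
    (hw : T.lca (label E L) (x ++ [σ]) q.1 = some w) :
    label E L (p.1 ++ σ :: w) ≠ label E L (x ++ σ :: w) := by
  rw [PartialPDFA.run_append_singleton _ hp] at hq
  split_ifs at hq with hσ
  -- `p.1 ++ [σ]` is sifted to `q`, hence agrees with `q` at `w`, where `x ++ [σ]` does not.
  have h1 := hT.consistent.label_eq_of_lca_eq_some ((build_trans h0 hσ).1 hq) hw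
  have h2 := Tree.label_ne_of_lca_eq_some hw
  rw [← h1] at h2
  simpa using h2.symm

end TreeInv

/-! ### Steps preserve the invariant and add leaves -/

theorem ncard_insert_acc [Finite (DefClass E L)] {T : Tree S (Option (Quotient E.rel))}
    (hT : TreeInv E L T) {x : List S} (hx : x ∉ T.acc) :
    (insert x T.acc).ncard = T.acc.ncard + 1 :=
  Set.ncard_insert_of_notMem hx hT.finite_acc

/-- Steps from the main loop return or preserve the invariant and add a leaf. -/
theorem step_loop [Finite (DefClass E L)] {T : Tree S (Option (Quotient E.rel))}
    (hT : TreeInv E L T) {c : Config S E} (h : Step E L (.loop T) c) :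
    (∃ H, c = .done H) ∨
      ∃ T', c = .loop T' ∧ TreeInv E L T' ∧ T'.acc.ncard = T.acc.ncard + 1 := by
  cases h with
  | siftNew T u σ hu hσ hs =>
    refine .inr ⟨_, rfl, hT.siftUpdate ((isDef_append_singleton _ _ _).2 ⟨hT.isDef u hu, hσ⟩) hs, ?_⟩
    rw [Tree.acc_siftUpdate hs]
    refine ncard_insert_acc hT fun hmem => ?_
    rw [hT.consistent.sift_eq_self hmem] at hs
    cases hs
  | loopReturn T h0 hc h => exact .inl ⟨_, rfl⟩
  | update T h0 hc γ hγ x σ hx hagree q hq w hw =>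
    obtain ⟨p, hp, hsp⟩ := hagree x List.prefix_rfl
    have hne := hT.label_ne_of_lca h0 hp hq hw
    refine .inr ⟨_, rfl, hT.split hsp hne, ?_⟩
    rw [Tree.acc_split hsp hne]
    refine ncard_insert_acc hT fun hmem => ?_
    rw [hT.consistent.sift_eq_self hmem, Option.some.injEq] at hsp
    -- A leaf `x` would be sifted to itself and so equal `p`, from which it was just separated.
    exact hne (by rw [← hsp])

/-- A string is defined if it is defined in an automaton that has no counterexample among its
proper prefixes. -/
theorem isDef_of_run {H : Hypothesis S} {x : List S} {q : H.acc} (hq : H.aut.run x = some q)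
    (hmin : ∀ y, y <+: x → y ≠ x → ¬ IsCounterexample E L H y) : IsDef L x := by
  induction x using List.reverseRecOn generalizing q with
  | nil => exact isDef_nil L
  | append_singleton x σ ih =>
    have hxσ := List.prefix_append x [σ]
    obtain ⟨p, hp⟩ := PartialPDFA.exists_run_of_prefix hxσ hq
    have hproper : ∀ y, y <+: x → ¬ IsCounterexample E L H y := by
      refine fun y hy => hmin y (hy.trans hxσ) ?_
      rintro rfl
      simpa using hy.length_le
    refine (isDef_append_singleton _ _ _).2 ⟨ih hp fun y hy _ => hproper y hy, ?_⟩
    -- The parent is no counterexample, so it has the same possible next symbols in `L` and in `H`.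
    have hrel : E.rel (L x) (H.aut.policy p) := by
      by_contra hne
      exact hproper x List.prefix_rfl ⟨p, hp, hne⟩
    rw [E.supp_eq _ _ hrel]
    rw [PartialPDFA.run_append_singleton _ hp] at hq
    by_contra hσ
    simp [hσ] at hq

theorem treeInv_initialTree {x : List S}
    (hbad : IsCounterexample E L (initialHypothesis L) x)
    (hmin : ∀ y, y <+: x → y ≠ x → ¬ IsCounterexample E L (initialHypothesis L) y) :
    TreeInv E L (initialTree E L x) := by
  obtain ⟨q, hq, hne⟩ := hbad
  have hq0 : q.1 = [] := q.2
  have hdef : IsDef L x := isDef_of_run hq hmin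
  have hlab : label E L ([] ++ []) ≠ label E L (x ++ []) := by
    intro h
    rw [List.append_nil, List.append_nil] at h
    apply hne
    change E.rel (L x) (L q.1)
    rw [hq0]
    exact rel_of_label_eq (isDef_nil L) h.symm
  exact {
    root := ⟨_, rfl⟩
    consistent := Tree.consistent_fork hlab
    nil_mem := by
      rw [initialTree, Tree.acc_fork hlab]
      exact .inr rfl
    isDef := by
      rw [initialTree, Tree.acc_fork hlab]
      rintro u (rfl | rfl)
      exacts [hdef, isDef_nil L] }

theorem step_start {c : Config S E} (h : Step E L .start c) :
    (∃ H, c = .done H) ∨ ∃ T, c = .loop T ∧ TreeInv E L T := by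
  cases h with
  | initReturn h => exact .inl ⟨_, rfl⟩
  | initTree γ x hγ hx hbad hmin => exact .inr ⟨_, rfl, treeInv_initialTree hbad hmin⟩

theorem not_step_done {H : Hypothesis S} {c : Config S E} : ¬ Step E L (.done H) c := nofun

/-- The invariant of the reachable configurations. -/
def ConfigInv (E : SuppEquiv S) (L : LanguageModel S) : Config S E → Prop
  | .start => True
  | .loop T => TreeInv E L T
  | .done H => H.Sound E L ∧ ∀ γ, ¬ IsCounterexample E L H γ

theorem ConfigInv.step [Finite (DefClass E L)] {c c' : Config S E} (hc : ConfigInv E L c)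
    (h : Step E L c c') : ConfigInv E L c' := by
  cases h with
  | initReturn h => exact ⟨sound_initialHypothesis, h⟩
  | initTree γ x hγ hx hbad hmin => exact treeInv_initialTree hbad hmin
  | loopReturn T h0 hT h => exact ⟨TreeInv.sound_build hc h0 hT, h⟩
  | siftNew T u σ hu hσ hs =>
    obtain ⟨H, h⟩ | ⟨T', h, hT', -⟩ := step_loop hc (.siftNew T u σ hu hσ hs)
    · cases h
    · cases h
      exact hT'
  | update T h0 hT γ hγ x σ hx hagree q hq w hw =>
    obtain ⟨H, h⟩ | ⟨T', h, hT', -⟩ := step_loop hc (.update T h0 hT γ hγ x σ hx hagree q hq w hw)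
    · cases h
    · cases h
      exact hT'

theorem configInv_of_reachable [Finite (DefClass E L)] {c : Config S E}
    (h : Relation.ReflTransGen (Step E L) .start c) : ConfigInv E L c := by
  induction h with
  | refl => trivial
  | tail _ h ih => exact ih.step h

/-! ### Termination and progress -/

theorem not_exists_infinite_run [Finite (DefClass E L)] :
    ¬ ∃ c : ℕ → Config S E, c 0 = .start ∧ ∀ n, Step E L (c n) (c (n + 1)) := by
  rintro ⟨c, h0, hc⟩
  -- The index is shifted because `c 0` has no tree. The bound ignores the initial leaves; only
  -- growth by one per step matters.
  have key : ∀ n, ∃ T, c (n + 1) = .loop T ∧ TreeInv E L T ∧ n ≤ T.acc.ncard := by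
    intro n
    induction n with
    | zero =>
      have h := hc 0
      rw [h0] at h
      obtain ⟨H, hH⟩ | ⟨T, hT, hinv⟩ := step_start h
      · have h1 := hc 1
        rw [zero_add] at hH
        rw [hH] at h1
        exact (not_step_done h1).elim
      · exact ⟨T, hT, hinv, Nat.zero_le _⟩
    | succ n ih =>
      obtain ⟨T, hT, hinv, hn⟩ := ih
      have h := hc (n + 1)
      rw [hT] at h
      obtain ⟨H, hH⟩ | ⟨T', hT', hinv', hcard⟩ := step_loop hinv h
      · have h1 := hc (n + 1 + 1)
        rw [hH] at h1
        exact (not_step_done h1).elim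
      · exact ⟨T', hT', hinv', by omega⟩
  obtain ⟨T, -, hinv, hn⟩ := key (Nat.card (DefClass E L) + 1)
  have := hinv.ncard_acc_le
  omega

theorem exists_step_start : ∃ c : Config S E, Step E L .start c := by
  by_cases h : ∀ γ, ¬ IsCounterexample E L (initialHypothesis L) γ
  · exact ⟨_, .initReturn h⟩
  · push Not at h
    obtain ⟨γ, hγ⟩ := h
    obtain ⟨x, hx, hbad, hmin⟩ := exists_minimal_prefix hγ
    exact ⟨_, .initTree γ x hγ hx hbad hmin⟩

theorem TreeInv.exists_step {T : Tree S (Option (Quotient E.rel))} (hT : TreeInv E L T) :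
    ∃ c, Step E L (.loop T) c := by
  by_cases hc : ∀ u ∈ T.acc, ∀ σ ∈ supp (L u), T.sift (label E L) (u ++ [σ]) ≠ none
  swap
  · push Not at hc
    obtain ⟨u, hu, σ, hσ, hs⟩ := hc
    exact ⟨_, .siftNew T u σ hu hσ hs⟩
  have h0 := hT.nil_mem
  by_cases h : ∀ γ, ¬ IsCounterexample E L (build E L T h0) γ
  · exact ⟨_, .loopReturn T h0 hc h⟩
  push Not at h
  obtain ⟨γ, hγ⟩ := h
  obtain ⟨qγ, hrun, hne⟩ := id hγ
  -- Failure includes a missing arc during sifting, so `P` does not presuppose that `y` reaches a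
  -- leaf.
  let P : List S → Prop := fun y =>
    ¬ ∃ p, (build E L T h0).aut.run y = some p ∧ T.sift (label E L) y = some p.1
  have hPγ : P γ := by
    rintro ⟨p, hp, hsp⟩
    rw [hrun, Option.some.injEq] at hp
    subst hp
    -- Being sifted to its own state would give `γ` an equivalent distribution there, by the root
    -- label.
    exact hne (rel_of_label_eq (hT.isDef _ qγ.2) (hT.label_eq_of_sift hsp))
  obtain ⟨z, hz, hPz, hmin⟩ := exists_minimal_prefix hPγ
  cases z using List.reverseRecOn with
  | nil => exact (hPz ⟨⟨[], h0⟩, rfl, hT.consistent.sift_eq_self h0⟩).elim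
  | append_singleton x σ =>
    obtain ⟨q, hq⟩ := PartialPDFA.exists_run_of_prefix hz hrun
    have hagree : ∀ y, y <+: x →
        ∃ p, (build E L T h0).aut.run y = some p ∧ T.sift (label E L) y = some p.1 := by
      intro y hy
      refine not_not.1 (hmin y (hy.trans (List.prefix_append _ _)) ?_)
      rintro rfl
      simpa using hy.length_le
    -- If no node separated them, `x ++ [σ]` would follow `q` to the leaf `q`, against `hPz`.
    have hlca : T.lca (label E L) (x ++ [σ]) q.1 ≠ none := fun hnone =>
      hPz ⟨q, hq, (Tree.sift_eq_of_lca_eq_none hnone).trans (hT.consistent.sift_eq_self q.2)⟩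
    obtain ⟨w, hw⟩ := Option.ne_none_iff_exists'.1 hlca
    exact ⟨_, .update T h0 hc γ hγ x σ hz hagree q hq w hw⟩

end OmitZero

theorem mainTheorem3 {S Q : Type*} [Fintype S] [Finite Q] (A : OmitZero.PDFA S Q)
    (E : OmitZero.SuppEquiv S) :
    -- no run is infinite
    (¬ ∃ c : ℕ → OmitZero.Config S E, c 0 = .start ∧
      ∀ n, OmitZero.Step E A.model (c n) (c (n + 1))) ∧
    -- no run gets stuck before it returns an automaton
    (∀ c, Relation.ReflTransGen (OmitZero.Step E A.model) .start c →
      (∃ H, c = .done H) ∨ ∃ c', OmitZero.Step E A.model c c') ∧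
    -- every returned automaton is the quotient, and is minimal
    (∀ H, Relation.ReflTransGen (OmitZero.Step E A.model) .start (.done H) →
      (∃ α : OmitZero.AccessChoice E A.model, H.aut.Iso (OmitZero.quotientPDFA A E α)) ∧
      Finite H.acc ∧ H.aut.EquivTo E A.model ∧
      ∀ (n : ℕ) (B : OmitZero.PartialPDFA S (Fin n)), B.EquivTo E A.model →
        Nat.card H.acc ≤ n) := by
  have := OmitZero.finite_defClass A E
  refine ⟨OmitZero.not_exists_infinite_run, fun c hc => ?_, fun H hH => ?_⟩
  · have hinv := OmitZero.configInv_of_reachable hc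
    cases c with
    | start => exact .inr OmitZero.exists_step_start
    | loop T => exact .inr (OmitZero.TreeInv.exists_step hinv)
    | done H => exact .inl ⟨H, rfl⟩
  · obtain ⟨hsound, hno⟩ := OmitZero.configInv_of_reachable hH
    have hequiv := hsound.equivTo hno
    refine ⟨hsound.exists_iso (hsound.toClass_bijective hequiv),
      Finite.of_injective _ hsound.toClass_injective, hequiv, fun n B hB => ?_⟩
    obtain ⟨f, hf⟩ := hB.exists_injective
    -- States of `H` inject into classes, and classes into states of `B`.
    simpa using Nat.card_le_card_of_injective _ (hf.comp hsound.toClass_injective)
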